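/- For a filter $c\in\mathbb R^\ell$ let $T(c)\in\mathbb R^{n\times n}$ be the circulant convolution matrix whose row $r$ has the entries $c_1,\dots,c_\ell$ in columns $r,r+1,\dots,r+\ell-1$ (modulo $n$). Let $U\in\mathbb R^{n\times n_1}$ be a fixed linear (e.g. upsampling or identity) operator and $B=[b_1,\dots,b_k]\in\mathbb R^{n_1\times k}$ a fixed input. The one-layer deep decoder is $$G(C)=\mathrm{relu}\Big(\Big[\sum_{j=1}^k T(c_{1j})Ub_j,\;\dots,\;\sum_{j=1}^k T(c_{kj})Ub_j\Big]\Big)\,c^{(2)}\in\mathbb R^n ,$$ with $\mathrm{relu}$ acting entrywise and $c^{(2)}\in\mathbb R^k$. In the case of parameterized filters, the parameters $C$ are all the filters $c_{ij}\in\mathbb R^\ell$ together with $c^{(2)}$. In the case of fixed filters, $c_{ij}=\gamma_{ij}g_{ij}$ with given $g_{ij}\in\mathbb R^\ell$, and the parameters $C$ are the scalars $\gamma_{ij}\in\mathbb R$ together with $c^{(2)}$. There are universal constants $K,\kappa>0$ such that the following holds for all $m,n,n_1,k,\ell$, all $U$, $B$ (and all $g_{ij}$ in the fixed case). Suppose that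 $$m\ \ge\ \begin{cases}K\,\ell k^2\log n & \text{if the filters are parameters},\\ K\,k^2\log n & \text{if the filters are fixed}.\end{cases}$$ Fix a signal $x^*\in\mathbb R^n$, a noise vector $\eta\in\mathbb R^m$ and $\varepsilon\ge 0$. Let $A\in\mathbb R^{m\times n}$ have i.i.d. Gaussian entries with mean $0$ and variance $1/m$, and let $y=Ax^*+\eta$. Then, with probability at least $1-e^{-\kappa m}$ over $A$, every $\hat C$ that minimizes $\|y-AG(C)\|_2$ over all $C$ to within an additive $\varepsilon$ of the optimum satisfies $$\|G(\hat C)-x^*\|_2\ \le\ 6\,\inf_{C}\|G(C)-x^*\|_2+\tfrac32\|\eta\|_2+2\varepsilon .$$ -/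

import Mathlib

open scoped Matrix NNReal
open MeasureTheory ProbabilityTheory

namespace DeepDecoder

noncomputable section

/-- The `n × n` convolution (circulant) matrix `T(c)` of a filter `c ∈ ℝ^ℓ`: row `r` carries
`c_0, c_1, …, c_{ℓ-1}` in the columns `r, r+1, …, r+ℓ-1`, taken modulo `n`. -/
def convMatrix (n : ℕ) {l : ℕ} (c : Fin l → ℝ) : Matrix (Fin n) (Fin n) ℝ :=
  Matrix.of fun r s => ∑ t : Fin l, if ((r : ℕ) + (t : ℕ)) % n = (s : ℕ) then c t else 0

/-- The channels after the convolutional layer: channel `i` is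
`relu (∑ j, T(c i j) U b_j)`, with `b_j` the `j`-th column of the input volume `B`,
`U` the (linear) upsampling operator and `relu` acting entrywise. -/
def channels {n n₁ k l : ℕ} (U : Matrix (Fin n) (Fin n₁) ℝ) (B : Matrix (Fin n₁) (Fin k) ℝ)
    (c : Fin k → Fin k → Fin l → ℝ) : Matrix (Fin n) (Fin k) ℝ :=
  Matrix.of fun r i =>
    max 0 ((∑ j : Fin k, convMatrix n (c i j) *ᵥ (U *ᵥ (fun p => B p j))) r)

/-- The one-layer deep decoder with parameterized filters: the parameters are all the filters
`c i j ∈ ℝ^ℓ` and the output weights `c₂ ∈ ℝ^k`. -/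
def decoder {n n₁ k : ℕ} (l : ℕ) (U : Matrix (Fin n) (Fin n₁) ℝ)
    (B : Matrix (Fin n₁) (Fin k) ℝ)
    (C : (Fin k → Fin k → Fin l → ℝ) × (Fin k → ℝ)) : EuclideanSpace ℝ (Fin n) :=
  WithLp.toLp 2 (channels U B C.1 *ᵥ C.2)

/-- The one-layer deep decoder with fixed filters `g i j ∈ ℝ^ℓ`: the parameters are the scalar
coefficients `c i j`, multiplying the fixed filters, and the output weights `c₂ ∈ ℝ^k`. -/
def fixedDecoder {n n₁ k l : ℕ} (U : Matrix (Fin n) (Fin n₁) ℝ)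
    (B : Matrix (Fin n₁) (Fin k) ℝ) (g : Fin k → Fin k → Fin l → ℝ)
    (C : (Fin k → Fin k → ℝ) × (Fin k → ℝ)) : EuclideanSpace ℝ (Fin n) :=
  decoder l U B (fun i j => C.1 i j • g i j, C.2)

/-- The law of an `m × n` random matrix with i.i.d. `N(0, 1/m)` entries. -/
def gaussianMatrixLaw (m n : ℕ) : Measure (Fin m → Fin n → ℝ) :=
  Measure.pi fun _ => Measure.pi fun _ => gaussianReal 0 (1 / (m : ℝ≥0))

/-- The residual `‖y - A x‖₂`. -/
def residual {m n : ℕ} (A : Matrix (Fin m) (Fin n) ℝ) (y : EuclideanSpace ℝ (Fin m))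
    (x : EuclideanSpace ℝ (Fin n)) : ℝ :=
  ‖y - Matrix.toEuclideanLin A x‖

/-- `Chat` minimizes `C ↦ ‖y - A G(C)‖₂` to within an additive `ε` of the optimum. -/
def IsApproxMinimizer {m n : ℕ} {Θ : Type} (G : Θ → EuclideanSpace ℝ (Fin n))
    (A : Matrix (Fin m) (Fin n) ℝ) (y : EuclideanSpace ℝ (Fin m)) (ε : ℝ) (Chat : Θ) : Prop :=
  residual A y (G Chat) ≤ (⨅ C : Θ, residual A y (G C)) + ε

/-- The set of measurement matrices (as arrays of entries) for which every `ε`-approximate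
minimizer of `‖y - A G(C)‖₂`, where `y = A x* + η`, obeys the recovery bound. -/
def recoveryEvent {m n : ℕ} {Θ : Type} (G : Θ → EuclideanSpace ℝ (Fin n))
    (xstar : EuclideanSpace ℝ (Fin n)) (η : EuclideanSpace ℝ (Fin m)) (ε : ℝ) :
    Set (Fin m → Fin n → ℝ) :=
  {a | ∀ Chat : Θ,
    IsApproxMinimizer G (Matrix.of a) (Matrix.toEuclideanLin (Matrix.of a) xstar + η) ε Chat →
      ‖G Chat - xstar‖ ≤ 6 * (⨅ C : Θ, ‖G C - xstar‖) + (3 / 2) * ‖η‖ + 2 * ε}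

/-- For each fixed signal `x*`, noise `η` and accuracy `ε ≥ 0`, the recovery bound holds with
probability at least `1 - exp (-c m)` over the Gaussian `m × n` matrix `A`. -/
def RecoversWithHighProb {n : ℕ} {Θ : Type} (m : ℕ) (c : ℝ)
    (G : Θ → EuclideanSpace ℝ (Fin n)) : Prop :=
  ∀ (xstar : EuclideanSpace ℝ (Fin n)) (η : EuclideanSpace ℝ (Fin m)) (ε : ℝ), 0 ≤ ε →
    ∃ E : Set (Fin m → Fin n → ℝ), MeasurableSet E ∧ E ⊆ recoveryEvent G xstar η ε ∧
      1 - Real.exp (-(c * m)) ≤ (gaussianMatrixLaw m n).real E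

end

end DeepDecoder

/-!
Once the activation pattern of every channel is fixed, the decoder is a linear map in the channel
parameters multiplied by their output weights. The activation patterns of a linear map from `ℝ^p`
to `ℝ^n` form a family of VC dimension at most `p`, so that there are at most `(n + 1) ^ p` of them
by the Sauer–Shelah lemma. With `k` channels the range of the decoder thus lies in a union of
`(n + 1) ^ (k p)` subspaces of dimension at most `k p`. A union bound over nets shows that the
Gaussian matrix is a near isometry on the spans of these subspaces with `x*`, and that it maps them
almost orthogonally to `η`. Without this orthogonality, near isometry alone would only give a
coefficient of `‖η‖` larger than `2`.

For `n = 1` the logarithm vanishes and `m` may be too small for the union bound. The range of the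
decoder is then `0` or everything, and in the second case the error is controlled by the orthogonal
projection of the noise onto the range of the Gaussian matrix.
-/

namespace DeepDecoder

open Module

/-! ### Gaussian vectors -/

section GaussianVector

variable {ι : Type*} [Fintype ι]

theorem map_dotProduct_pi_gaussianReal (v : ℝ≥0) (x : EuclideanSpace ℝ ι) :
    (Measure.pi fun _ : ι => gaussianReal 0 v).map (· ⬝ᵥ x) = gaussianReal 0 (v * ‖x‖₊ ^ 2) := by
  have hmeas : Measurable fun a : ι → ℝ => a ⬝ᵥ x := by unfold dotProduct; fun_prop
  have : IsProbabilityMeasure ((Measure.pi fun _ : ι => gaussianReal 0 v).map (· ⬝ᵥ x)) :=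
    Measure.isProbabilityMeasure_map hmeas.aemeasurable
  refine Measure.ext_of_charFun (funext fun t => ?_)
  have hcharFun : charFun ((Measure.pi fun _ : ι => gaussianReal 0 v).map (· ⬝ᵥ x)) t =
      charFun ((Measure.pi fun _ : ι => gaussianReal 0 v).map (WithLp.toLp 2)) (t • x) := by
    rw [charFun, charFun, integral_map hmeas.aemeasurable (by fun_prop),
      integral_map (by fun_prop) (by fun_prop)]
    congr! 5 with a
    simp [PiLp.inner_apply, dotProduct, Finset.mul_sum, mul_comm, mul_left_comm]
  have hnorm : (‖x‖ : ℂ) ^ 2 = ∑ i, (x i : ℂ) ^ 2 := by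
    exact_mod_cast EuclideanSpace.real_norm_sq_eq x
  rw [hcharFun, charFun_pi, charFun_gaussianReal]
  simp only [charFun_gaussianReal, ← Complex.exp_sum]
  congr 1
  push_cast
  simp only [hnorm, PiLp.smul_apply, smul_eq_mul, Complex.ofReal_mul, mul_zero, zero_mul, zero_sub,
    Finset.mul_sum, Finset.sum_mul, Finset.sum_div, ← Finset.sum_neg_distrib]
  exact Finset.sum_congr rfl fun i _ => by ring

variable {w : ℝ≥0} {s : ℝ}

theorem gaussianPDFReal_smul_exp_mul_sq (hw : w ≠ 0) (s z : ℝ) :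
    gaussianPDFReal 0 w z • Real.exp (s * z ^ 2) =
      (√(2 * Real.pi * w))⁻¹ * Real.exp (-((1 - 2 * s * w) / (2 * w)) * z ^ 2) := by
  have hw' : (w : ℝ) ≠ 0 := NNReal.coe_ne_zero.2 hw
  rw [gaussianPDFReal, smul_eq_mul, mul_assoc, ← Real.exp_add]
  congr 2
  field_simp
  ring

theorem integrable_exp_mul_sq_gaussianReal (hw : w ≠ 0) (hs : 2 * s * w < 1) :
    Integrable (fun z : ℝ => Real.exp (s * z ^ 2)) (gaussianReal 0 w) := by
  rw [gaussianReal_of_var_ne_zero 0 hw,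
    integrable_withDensity_iff_integrable_smul' (measurable_gaussianPDF 0 w)
      (Filter.Eventually.of_forall fun _ => gaussianPDF_lt_top)]
  simp only [toReal_gaussianPDF, gaussianPDFReal_smul_exp_mul_sq hw]
  exact (integrable_exp_neg_mul_sq (div_pos (sub_pos.2 hs) (by positivity))).const_mul _

theorem integral_exp_mul_sq_gaussianReal (hw : w ≠ 0) (hs : 2 * s * w < 1) :
    ∫ z, Real.exp (s * z ^ 2) ∂gaussianReal 0 w = (√(1 - 2 * s * w))⁻¹ := by
  have : 1 - 2 * s * w ≠ 0 := (sub_pos.2 hs).ne'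
  rw [integral_gaussianReal_eq_integral_smul hw]
  simp only [gaussianPDFReal_smul_exp_mul_sq hw]
  rw [integral_const_mul, integral_gaussian, ← Real.sqrt_inv, ← Real.sqrt_mul (by positivity),
    ← Real.sqrt_inv]
  congr 1
  field_simp

theorem integrable_exp_mul_sum_sq_pi_gaussianReal (hw : w ≠ 0) (hs : 2 * s * w < 1) :
    Integrable (fun z : ι → ℝ => Real.exp (s * ∑ i, z i ^ 2))
      (Measure.pi fun _ => gaussianReal 0 w) := by
  simp_rw [Finset.mul_sum, Real.exp_sum]
  exact Integrable.fintype_prod fun _ => integrable_exp_mul_sq_gaussianReal hw hs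

theorem mgf_sum_sq_pi_gaussianReal (hw : w ≠ 0) (hs : 2 * s * w < 1) :
    mgf (fun z : ι → ℝ => ∑ i, z i ^ 2) (Measure.pi fun _ => gaussianReal 0 w) s =
      (√(1 - 2 * s * w))⁻¹ ^ Fintype.card ι := by
  simp_rw [mgf, Finset.mul_sum, Real.exp_sum]
  rw [integral_fintype_prod_eq_prod (fun _ (z : ℝ) => Real.exp (s * z ^ 2))]
  simp_rw [integral_exp_mul_sq_gaussianReal hw hs, Finset.prod_const, Finset.card_univ]

-- `s = (1 - r⁻²) / (2 w)` minimizes the Chernoff bound `exp (-s r² n w) (1 - 2 s w) ^ (-n / 2)`.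
theorem exp_mul_mgf_sum_sq_pi_gaussianReal_le (hw : w ≠ 0) {r : ℝ} (hr : 0 < r)
    (hs : s = (1 - (r ^ 2)⁻¹) / (2 * w)) :
    Real.exp (-s * (r ^ 2 * (Fintype.card ι * w))) *
        mgf (fun z : ι → ℝ => ∑ i, z i ^ 2) (Measure.pi fun _ => gaussianReal 0 w) s ≤
      Real.exp (-(Fintype.card ι * (r - 1) ^ 2 / 2)) := by
  have hw' : (w : ℝ) ≠ 0 := NNReal.coe_ne_zero.2 hw
  have hsw : 1 - 2 * s * w = (r ^ 2)⁻¹ := by rw [hs]; field_simp; ring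
  have hs1 : 2 * s * w < 1 := sub_pos.1 (hsw ▸ by positivity)
  have hr' : r ≤ Real.exp (r - 1) := by simpa using Real.add_one_le_exp (r - 1)
  rw [mgf_sum_sq_pi_gaussianReal hw hs1, hsw, Real.sqrt_inv, inv_inv, Real.sqrt_sq hr.le]
  calc Real.exp (-s * (r ^ 2 * (Fintype.card ι * w))) * r ^ Fintype.card ι
      ≤ Real.exp (-s * (r ^ 2 * (Fintype.card ι * w))) * Real.exp (r - 1) ^ Fintype.card ι := by
        gcongr
    _ = Real.exp (-(Fintype.card ι * (r - 1) ^ 2 / 2)) := by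
        rw [← Real.exp_nat_mul, ← Real.exp_add, hs]
        congr 1
        field_simp
        ring

theorem pi_gaussianReal_le_sum_sq_le (hw : w ≠ 0) {r : ℝ} (hr : 1 ≤ r) :
    (Measure.pi fun _ : ι => gaussianReal 0 w).real
        {z | r ^ 2 * (Fintype.card ι * w) ≤ ∑ i, z i ^ 2} ≤
      Real.exp (-(Fintype.card ι * (r - 1) ^ 2 / 2)) := by
  have hw' : (w : ℝ) ≠ 0 := NNReal.coe_ne_zero.2 hw
  have hr0 : 0 < r := by positivity
  have hs1 : 2 * ((1 - (r ^ 2)⁻¹) / (2 * w)) * w < 1 := by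
    field_simp
    linarith
  have hs0 : 0 ≤ (1 - (r ^ 2)⁻¹) / (2 * w) :=
    div_nonneg (sub_nonneg.2 (inv_le_one_of_one_le₀ (one_le_pow₀ hr))) (by positivity)
  exact (measure_ge_le_exp_mul_mgf _ hs0 (integrable_exp_mul_sum_sq_pi_gaussianReal hw hs1)).trans
    (exp_mul_mgf_sum_sq_pi_gaussianReal_le hw hr0 rfl)

theorem pi_gaussianReal_sum_sq_le_le (hw : w ≠ 0) {r : ℝ} (hr0 : 0 < r) (hr : r ≤ 1) :
    (Measure.pi fun _ : ι => gaussianReal 0 w).real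
        {z | ∑ i, z i ^ 2 ≤ r ^ 2 * (Fintype.card ι * w)} ≤
      Real.exp (-(Fintype.card ι * (r - 1) ^ 2 / 2)) := by
  have hw' : (w : ℝ) ≠ 0 := NNReal.coe_ne_zero.2 hw
  have hs1 : 2 * ((1 - (r ^ 2)⁻¹) / (2 * w)) * w < 1 := by
    field_simp
    linarith
  have hs0 : (1 - (r ^ 2)⁻¹) / (2 * w) ≤ 0 :=
    div_nonpos_of_nonpos_of_nonneg
      (sub_nonpos.2 ((one_le_inv₀ (by positivity)).2 (pow_le_one₀ hr0.le hr))) (by positivity)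
  exact (measure_le_le_exp_mul_mgf _ hs0 (integrable_exp_mul_sum_sq_pi_gaussianReal hw hs1)).trans
    (exp_mul_mgf_sum_sq_pi_gaussianReal_le hw hr0 rfl)

theorem gaussianReal_le_abs_le (w : ℝ≥0) {r : ℝ} (hr : 0 ≤ r) :
    (gaussianReal 0 w).real {z | r ≤ |z|} ≤ 2 * Real.exp (-r ^ 2 / (2 * w)) := by
  have hsub : HasSubgaussianMGF id w (gaussianReal 0 w) :=
    ⟨integrable_exp_mul_gaussianReal, fun t => by
      rw [mgf_gaussianReal Measure.map_id]; simp⟩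
  have hunion : {z : ℝ | r ≤ |z|} = {z | r ≤ id z} ∪ {z | r ≤ (-id) z} := by
    ext z
    simp [le_abs]
  calc (gaussianReal 0 w).real {z | r ≤ |z|}
      ≤ (gaussianReal 0 w).real {z | r ≤ id z} + (gaussianReal 0 w).real {z | r ≤ (-id) z} :=
        hunion ▸ measureReal_union_le _ _
    _ ≤ 2 * Real.exp (-r ^ 2 / (2 * w)) := by
        linarith [hsub.measure_ge_le hr, hsub.neg.measure_ge_le hr]

end GaussianVector

/-! ### Gaussian matrices -/

section GaussianMatrix

variable {m n : ℕ}

instance : IsProbabilityMeasure (gaussianMatrixLaw m n) := by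
  unfold gaussianMatrixLaw
  infer_instance

theorem measurable_toEuclideanLin_of (x : EuclideanSpace ℝ (Fin n)) :
    Measurable fun a : Fin m → Fin n → ℝ => Matrix.toEuclideanLin (Matrix.of a) x := by
  have happly : (fun a : Fin m → Fin n → ℝ => Matrix.toEuclideanLin (Matrix.of a) x) =
      fun a => WithLp.toLp 2 fun i => ∑ j, a i j * x j := rfl
  rw [happly]
  fun_prop

theorem measurable_inner_toEuclideanLin_of (x : EuclideanSpace ℝ (Fin n))
    (η : EuclideanSpace ℝ (Fin m)) :
    Measurable fun a : Fin m → Fin n → ℝ =>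
      inner ℝ (Matrix.toEuclideanLin (Matrix.of a) x) η :=
  (measurable_toEuclideanLin_of x).inner measurable_const

theorem norm_toEuclideanLin_of_sq (a : Fin m → Fin n → ℝ) (x : EuclideanSpace ℝ (Fin n)) :
    ‖Matrix.toEuclideanLin (Matrix.of a) x‖ ^ 2 = ∑ i, (a i ⬝ᵥ x) ^ 2 :=
  EuclideanSpace.real_norm_sq_eq _

theorem measurable_dotProduct_rows (x : EuclideanSpace ℝ (Fin n)) :
    Measurable fun (a : Fin m → Fin n → ℝ) i => a i ⬝ᵥ x := by
  unfold dotProduct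
  fun_prop

theorem map_dotProduct_gaussianMatrixLaw (x : EuclideanSpace ℝ (Fin n)) :
    (gaussianMatrixLaw m n).map (fun a i => a i ⬝ᵥ x) =
      Measure.pi fun _ : Fin m => gaussianReal 0 (1 / (m : ℝ≥0) * ‖x‖₊ ^ 2) := by
  have hrow := map_dotProduct_pi_gaussianReal (1 / (m : ℝ≥0)) x
  have hmeas : Measurable fun b : Fin n → ℝ => b ⬝ᵥ x := by unfold dotProduct; fun_prop
  have : ∀ _ : Fin m, SigmaFinite
      ((Measure.pi fun _ : Fin n => gaussianReal 0 (1 / (m : ℝ≥0))).map (· ⬝ᵥ x)) :=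
    fun _ => hrow ▸ inferInstance
  rw [gaussianMatrixLaw, Measure.pi_map_pi (f := fun _ (b : Fin n → ℝ) => b ⬝ᵥ x)
    (fun _ => hmeas.aemeasurable), hrow]

theorem map_inner_gaussianMatrixLaw (x : EuclideanSpace ℝ (Fin n))
    (η : EuclideanSpace ℝ (Fin m)) :
    (gaussianMatrixLaw m n).map (fun a => inner ℝ (Matrix.toEuclideanLin (Matrix.of a) x) η) =
      gaussianReal 0 (1 / (m : ℝ≥0) * ‖x‖₊ ^ 2 * ‖η‖₊ ^ 2) := by
  rw [← map_dotProduct_pi_gaussianReal, ← map_dotProduct_gaussianMatrixLaw,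
    Measure.map_map (by unfold dotProduct; fun_prop) (measurable_dotProduct_rows x)]
  congr 1
  ext a
  simp [PiLp.inner_apply, Matrix.toLpLin_apply, Matrix.mulVec, dotProduct, mul_comm]

theorem sq_mul_card_mul_nnnorm_sq (hm : m ≠ 0) (r : ℝ) (x : EuclideanSpace ℝ (Fin n)) :
    r ^ 2 * (Fintype.card (Fin m) * (1 / (m : ℝ≥0) * ‖x‖₊ ^ 2 : ℝ≥0)) = (r * ‖x‖) ^ 2 := by
  have hm' : (m : ℝ) ≠ 0 := Nat.cast_ne_zero.2 hm
  rw [Fintype.card_fin]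
  push_cast
  field_simp

theorem gaussianMatrixLaw_lt_norm_le (x : EuclideanSpace ℝ (Fin n)) {δ : ℝ} (hδ : 0 ≤ δ) :
    (gaussianMatrixLaw m n).real {a | (1 + δ) * ‖x‖ < ‖Matrix.toEuclideanLin (Matrix.of a) x‖} ≤
      Real.exp (-(m * δ ^ 2 / 2)) := by
  rcases eq_or_ne m 0 with rfl | hm
  · simp
  rcases eq_or_ne x 0 with rfl | hx
  · simp [Real.exp_nonneg]
  have hw : 1 / (m : ℝ≥0) * ‖x‖₊ ^ 2 ≠ 0 := by
    have := nnnorm_ne_zero_iff.2 hx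
    positivity
  have htail := pi_gaussianReal_le_sum_sq_le (ι := Fin m) hw (r := 1 + δ) (by linarith)
  rw [← map_dotProduct_gaussianMatrixLaw x, map_measureReal_apply (measurable_dotProduct_rows x)
    (measurableSet_le (by fun_prop) (by fun_prop)), sq_mul_card_mul_nnnorm_sq hm, Fintype.card_fin,
    add_sub_cancel_left] at htail
  refine (measureReal_mono fun a ha => ?_).trans htail
  rw [Set.mem_preimage, Set.mem_ofPred_eq, ← norm_toEuclideanLin_of_sq]
  exact pow_le_pow_left₀ (by positivity) (Set.mem_ofPred.1 ha).le 2

theorem gaussianMatrixLaw_norm_lt_le (x : EuclideanSpace ℝ (Fin n)) {δ : ℝ} (hδ : 0 ≤ δ)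
    (hδ' : δ < 1) :
    (gaussianMatrixLaw m n).real {a | ‖Matrix.toEuclideanLin (Matrix.of a) x‖ < (1 - δ) * ‖x‖} ≤
      Real.exp (-(m * δ ^ 2 / 2)) := by
  rcases eq_or_ne m 0 with rfl | hm
  · simp
  rcases eq_or_ne x 0 with rfl | hx
  · simp [Real.exp_nonneg]
  have hw : 1 / (m : ℝ≥0) * ‖x‖₊ ^ 2 ≠ 0 := by
    have := nnnorm_ne_zero_iff.2 hx
    positivity
  have htail := pi_gaussianReal_sum_sq_le_le (ι := Fin m) hw (r := 1 - δ) (by linarith)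
    (by linarith)
  rw [← map_dotProduct_gaussianMatrixLaw x, map_measureReal_apply (measurable_dotProduct_rows x)
    (measurableSet_le (by fun_prop) (by fun_prop)), sq_mul_card_mul_nnnorm_sq hm, Fintype.card_fin,
    sub_sub_cancel_left, neg_sq] at htail
  refine (measureReal_mono fun a ha => ?_).trans htail
  rw [Set.mem_preimage, Set.mem_ofPred_eq, ← norm_toEuclideanLin_of_sq]
  exact pow_le_pow_left₀ (norm_nonneg _) (Set.mem_ofPred.1 ha).le 2

theorem gaussianMatrixLaw_lt_abs_inner_le (x : EuclideanSpace ℝ (Fin n))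
    (η : EuclideanSpace ℝ (Fin m)) {δ : ℝ} (hδ : 0 ≤ δ) :
    (gaussianMatrixLaw m n).real
        {a | δ * (‖x‖ * ‖η‖) < |inner ℝ (Matrix.toEuclideanLin (Matrix.of a) x) η|} ≤
      2 * Real.exp (-(m * δ ^ 2 / 2)) := by
  rcases eq_or_ne x 0 with rfl | hx
  · simp [Real.exp_nonneg]
  rcases eq_or_ne η 0 with rfl | hη
  · simp [Real.exp_nonneg]
  have hx' : ‖x‖ ≠ 0 := norm_ne_zero_iff.2 hx
  have hη' : ‖η‖ ≠ 0 := norm_ne_zero_iff.2 hη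
  have hexp : -(δ * (‖x‖ * ‖η‖)) ^ 2 / (2 * (1 / (m : ℝ≥0) * ‖x‖₊ ^ 2 * ‖η‖₊ ^ 2 : ℝ≥0)) =
      -(m * δ ^ 2 / 2) := by
    push_cast
    field_simp
  have htail := gaussianReal_le_abs_le (1 / (m : ℝ≥0) * ‖x‖₊ ^ 2 * ‖η‖₊ ^ 2)
    (r := δ * (‖x‖ * ‖η‖)) (by positivity)
  rw [hexp, ← map_inner_gaussianMatrixLaw x η,
    map_measureReal_apply (measurable_inner_toEuclideanLin_of x η)
      (measurableSet_le (by fun_prop) (by fun_prop))] at htail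
  refine (measureReal_mono fun a ha => ?_).trans htail
  exact Set.mem_preimage.2 (Set.mem_ofPred.2 (Set.mem_ofPred.1 ha).le)

end GaussianMatrix

/-! ### Near isometries -/

/-- The linear map `A` distorts the length of `x` by a factor of at most `1 ± δ`, and `A x` is
almost orthogonal to `η`. This is the property of a measurement matrix, at a difference `x` of
signals, that makes recovery under the noise `η` stable. -/
structure IsNearIsometryAt {E F : Type*} [NormedAddCommGroup E] [NormedSpace ℝ E]
    [NormedAddCommGroup F] [InnerProductSpace ℝ F] (A : E →ₗ[ℝ] F) (η : F) (δ : ℝ) (x : E) :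
    Prop where
  le_norm : (1 - δ) * ‖x‖ ≤ ‖A x‖
  norm_le : ‖A x‖ ≤ (1 + δ) * ‖x‖
  abs_inner_le : |inner ℝ (A x) η| ≤ δ * (‖x‖ * ‖η‖)

section NearIsometry

variable {m n : ℕ}

theorem measurableSet_isNearIsometryAt (η : EuclideanSpace ℝ (Fin m)) (δ : ℝ)
    (x : EuclideanSpace ℝ (Fin n)) :
    MeasurableSet {a : Fin m → Fin n → ℝ |
      IsNearIsometryAt (Matrix.toEuclideanLin (Matrix.of a)) η δ x} := by
  have hnorm := (measurable_toEuclideanLin_of (m := m) x).norm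
  have hinner := (measurable_inner_toEuclideanLin_of x η).norm
  have hmeas := ((measurableSet_le (measurable_const (a := (1 - δ) * ‖x‖)) hnorm).inter
    (measurableSet_le hnorm (measurable_const (a := (1 + δ) * ‖x‖)))).inter
    (measurableSet_le hinner (measurable_const (a := δ * (‖x‖ * ‖η‖))))
  refine hmeas.congr (Set.ext fun a => ?_)
  exact ⟨fun h => ⟨h.1.1, h.1.2, h.2⟩, fun h => ⟨⟨h.le_norm, h.norm_le⟩, h.abs_inner_le⟩⟩

theorem gaussianMatrixLaw_not_isNearIsometryAt_le (η : EuclideanSpace ℝ (Fin m)) {δ : ℝ}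
    (hδ : 0 ≤ δ) (hδ' : δ < 1) (x : EuclideanSpace ℝ (Fin n)) :
    (gaussianMatrixLaw m n).real
        {a | ¬ IsNearIsometryAt (Matrix.toEuclideanLin (Matrix.of a)) η δ x} ≤
      4 * Real.exp (-(m * δ ^ 2 / 2)) := by
  have hsub : {a : Fin m → Fin n → ℝ |
        ¬ IsNearIsometryAt (Matrix.toEuclideanLin (Matrix.of a)) η δ x} ⊆
      {a | ‖Matrix.toEuclideanLin (Matrix.of a) x‖ < (1 - δ) * ‖x‖} ∪
        ({a | (1 + δ) * ‖x‖ < ‖Matrix.toEuclideanLin (Matrix.of a) x‖} ∪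
          {a | δ * (‖x‖ * ‖η‖) < |inner ℝ (Matrix.toEuclideanLin (Matrix.of a) x) η|}) := by
    intro a ha
    by_contra hbounds
    simp only [Set.mem_union, Set.mem_ofPred_eq, not_or, not_lt] at hbounds
    exact ha ⟨hbounds.1, hbounds.2.1, hbounds.2.2⟩
  refine (measureReal_mono hsub).trans ((measureReal_union_le _ _).trans
    ((add_le_add_right (measureReal_union_le _ _) _).trans ?_))
  linarith [gaussianMatrixLaw_norm_lt_le (m := m) x hδ hδ',
    gaussianMatrixLaw_lt_norm_le (m := m) x hδ, gaussianMatrixLaw_lt_abs_inner_le x η hδ]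

theorem le_gaussianMatrixLaw_forall_isNearIsometryAt (η : EuclideanSpace ℝ (Fin m)) {δ : ℝ}
    (hδ : 0 ≤ δ) (hδ' : δ < 1) (T : Finset (EuclideanSpace ℝ (Fin n))) :
    1 - T.card * (4 * Real.exp (-(m * δ ^ 2 / 2))) ≤ (gaussianMatrixLaw m n).real
      {a | ∀ x ∈ T, IsNearIsometryAt (Matrix.toEuclideanLin (Matrix.of a)) η δ x} := by
  have hcompl : {a : Fin m → Fin n → ℝ |
        ∀ x ∈ T, IsNearIsometryAt (Matrix.toEuclideanLin (Matrix.of a)) η δ x} =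
      (⋃ x ∈ T, {a | ¬ IsNearIsometryAt (Matrix.toEuclideanLin (Matrix.of a)) η δ x})ᶜ := by
    ext a
    simp
  have hmeas : MeasurableSet (⋃ x ∈ T, {a : Fin m → Fin n → ℝ |
      ¬ IsNearIsometryAt (Matrix.toEuclideanLin (Matrix.of a)) η δ x}) :=
    T.measurableSet_biUnion fun x _ => (measurableSet_isNearIsometryAt η δ x).compl
  rw [hcompl, probReal_compl_eq_one_sub hmeas]
  refine sub_le_sub_left ((measureReal_biUnion_finset_le _ _).trans ?_) _
  simpa using Finset.sum_le_card_nsmul T _ _ fun x _ =>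
    gaussianMatrixLaw_not_isNearIsometryAt_le η hδ hδ' x

end NearIsometry

/-! ### Nets of unit spheres -/

section Net

open Metric

variable {E : Type*} [NormedAddCommGroup E] [NormedSpace ℝ E] [FiniteDimensional ℝ E] {ε : ℝ≥0}

theorem card_le_of_isSeparated {s : Finset E} (hε : 0 < ε) (hs : ∀ x ∈ s, ‖x‖ ≤ 1)
    (hsep : IsSeparated (ε : ENNReal) (s : Set E)) : (s.card : ℝ) ≤ (1 + 2 / ε) ^ finrank ℝ E := by
  borelize E
  let μ : Measure E := Measure.addHaar
  have hε' : (0 : ℝ) < ε := NNReal.coe_pos.2 hε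
  have hvol : ∀ r : ℝ, 0 < r → μ.real (ball 0 r) = r ^ finrank ℝ E * μ.real (ball 0 1) :=
    fun r hr => by
      rw [measureReal_def, measureReal_def, Measure.addHaar_ball_of_pos μ 0 hr, ENNReal.toReal_mul,
        ENNReal.toReal_ofReal (by positivity)]
  have hdisj : (s : Set E).PairwiseDisjoint fun x => ball x (ε / 2 : ℝ) := by
    intro x hx y hy hxy
    refine ball_disjoint_ball ?_
    have hdist : (ε : ENNReal) < edist x y := hsep hx hy hxy
    rw [edist_nndist, ENNReal.coe_lt_coe, ← NNReal.coe_lt_coe, coe_nndist] at hdist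
    linarith
  have hsub : ⋃ x ∈ s, ball x (ε / 2 : ℝ) ⊆ ball 0 (1 + ε / 2) :=
    Set.iUnion₂_subset fun x hx => ball_subset_ball' (by linarith [hs x hx, dist_zero_right x])
  have hpack : s.card * μ.real (ball 0 (ε / 2 : ℝ)) ≤ μ.real (ball 0 (1 + ε / 2 : ℝ)) := by
    have := measureReal_mono (μ := μ) hsub measure_ball_lt_top.ne
    rwa [measureReal_biUnion_finset hdisj fun _ _ => measurableSet_ball,
      Finset.sum_congr rfl fun x _ => Measure.addHaar_real_ball_center μ x _, Finset.sum_const,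
      nsmul_eq_mul] at this
  rw [hvol (ε / 2) (by positivity), hvol (1 + ε / 2) (by positivity), ← mul_assoc] at hpack
  have hunit : 0 < μ.real (ball 0 1) :=
    ENNReal.toReal_pos (measure_ball_pos μ 0 one_pos).ne' measure_ball_lt_top.ne
  rw [← mul_le_mul_iff_of_pos_right (pow_pos (half_pos hε') (finrank ℝ E)), ← mul_pow]
  convert le_of_mul_le_mul_right hpack hunit using 2
  field_simp
  ring

theorem exists_finset_isCover_sphere (hε : 0 < ε) :
    ∃ s : Finset E, (∀ x ∈ s, ‖x‖ = 1) ∧ IsCover ε (sphere (0 : E) 1) (s : Set E) ∧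
      (s.card : ℝ) ≤ (1 + 2 / ε) ^ finrank ℝ E := by
  have : ProperSpace E := FiniteDimensional.proper_real E
  obtain ⟨t, -, htfin, ht⟩ := exists_finite_isCover_of_isCompact (half_pos hε).ne'
    (isCompact_sphere (0 : E) 1)
  have hpack : packingNumber ε (sphere (0 : E) 1) ≠ ⊤ := by
    refine ne_top_of_le_ne_top htfin.encard_lt_top.ne ?_
    have := packingNumber_two_mul_le_externalCoveringNumber (ε / 2) (sphere (0 : E) 1)
    rw [mul_div_cancel₀ ε two_ne_zero] at this
    exact this.trans ht.externalCoveringNumber_le_encard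
  have hfin : (maximalSeparatedSet ε (sphere (0 : E) 1)).Finite :=
    Set.encard_ne_top_iff.1 (encard_maximalSeparatedSet hpack ▸ hpack)
  have hnorm : ∀ x ∈ hfin.toFinset, ‖x‖ = 1 := fun x hx =>
    mem_sphere_zero_iff_norm.1 (maximalSeparatedSet_subset (hfin.mem_toFinset.1 hx))
  refine ⟨hfin.toFinset, hnorm, ?_, card_le_of_isSeparated hε (fun x hx => (hnorm x hx).le) ?_⟩
  · simpa using isCover_maximalSeparatedSet hpack
  · simpa using isSeparated_maximalSeparatedSet

end Net

section OperatorNorm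

open Metric

variable {E F : Type*} [NormedAddCommGroup E] [NormedSpace ℝ E] [NormedAddCommGroup F]
  [NormedSpace ℝ F] {ε : ℝ≥0} {s : Set E} {b : ℝ}

theorem exists_mem_norm_map_sub_le (hs : IsCover ε (sphere (0 : E) 1) s) (f : E →L[ℝ] F) {x : E}
    (hx : ‖x‖ = 1) : ∃ c ∈ s, ‖f x - f c‖ ≤ ‖f‖ * ε := by
  obtain ⟨c, hc, hxc⟩ := hs (mem_sphere_zero_iff_norm.2 hx)
  refine ⟨c, hc, ?_⟩
  rw [← map_sub]
  refine f.le_opNorm_of_le ?_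
  rw [← dist_eq_norm]
  exact_mod_cast edist_le_coe.1 hxc

theorem opNorm_le_of_isCover_sphere (hs : IsCover ε (sphere (0 : E) 1) s) (hε : ε < 1)
    (f : E →L[ℝ] F) (hb : 0 ≤ b) (hf : ∀ c ∈ s, ‖f c‖ ≤ b) : ‖f‖ ≤ b / (1 - ε) := by
  have hself : ‖f‖ ≤ b + ‖f‖ * ε := by
    refine f.opNorm_le_of_unit_norm (by positivity) fun x hx => ?_
    obtain ⟨c, hc, hxc⟩ := exists_mem_norm_map_sub_le hs f hx
    linarith [hf c hc, norm_sub_norm_le (f x) (f c)]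
  have hε' : (ε : ℝ) < 1 := hε
  rw [le_div_iff₀ (sub_pos.2 hε')]
  linarith

theorem le_norm_of_isCover_sphere (hs : IsCover ε (sphere (0 : E) 1) s) (f : E →L[ℝ] F)
    (hf : ∀ c ∈ s, b ≤ ‖f c‖) (x : E) : (b - ‖f‖ * ε) * ‖x‖ ≤ ‖f x‖ := by
  have hunit : ∀ x : E, ‖x‖ = 1 → b - ‖f‖ * ε ≤ ‖f x‖ := by
    intro x hx
    obtain ⟨c, hc, hxc⟩ := exists_mem_norm_map_sub_le hs f hx
    linarith [hf c hc, norm_sub_norm_le (f c) (f x), norm_sub_rev (f c) (f x)]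
  rcases eq_or_ne x 0 with rfl | hx
  · simp
  have hx' : 0 < ‖x‖ := norm_pos_iff.2 hx
  have hscaled := hunit (‖x‖⁻¹ • x) (by simp [norm_smul, hx'.ne'])
  rwa [map_smul, norm_smul, norm_inv, norm_norm, ← div_eq_inv_mul, le_div_iff₀ hx'] at hscaled

end OperatorNorm

theorem IsNearIsometryAt.of_isCover_sphere {E F : Type*} [NormedAddCommGroup E] [NormedSpace ℝ E]
    [FiniteDimensional ℝ E] [NormedAddCommGroup F] [InnerProductSpace ℝ F] {A : E →ₗ[ℝ] F} {η : F}
    {δ : ℝ} {ε : ℝ≥0} {s : Set E} (hs : Metric.IsCover ε (Metric.sphere (0 : E) 1) s) (hε : ε < 1)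
    (hδ : 0 ≤ δ) (hnorm : ∀ c ∈ s, ‖c‖ = 1) (hA : ∀ c ∈ s, IsNearIsometryAt A η δ c) (x : E) :
    IsNearIsometryAt A η ((δ + ε) / (1 - ε)) x := by
  let f : E →L[ℝ] F := LinearMap.toContinuousLinearMap A
  let g : E →L[ℝ] ℝ := innerSL ℝ η ∘L f
  have hε' : (0 : ℝ) < 1 - ε := sub_pos.2 hε
  have hf : ‖f‖ ≤ (1 + δ) / (1 - ε) :=
    opNorm_le_of_isCover_sphere hs hε f (by positivity) fun c hc => by
      simpa [hnorm c hc, f] using (hA c hc).norm_le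
  have hg : ‖g‖ ≤ δ * ‖η‖ / (1 - ε) :=
    opNorm_le_of_isCover_sphere hs hε g (by positivity) fun c hc => by
      simpa [hnorm c hc, g, f, real_inner_comm] using (hA c hc).abs_inner_le
  refine ⟨?_, ?_, ?_⟩
  · calc (1 - (δ + ε) / (1 - ε)) * ‖x‖ = (1 - δ - (1 + δ) / (1 - ε) * ε) * ‖x‖ := by
          field_simp; ring
      _ ≤ (1 - δ - ‖f‖ * ε) * ‖x‖ := by gcongr
      _ ≤ ‖f x‖ := le_norm_of_isCover_sphere hs f
          (fun c hc => by simpa [hnorm c hc, f] using (hA c hc).le_norm) x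
  · refine (f.le_of_opNorm_le hf x).trans (le_of_eq ?_)
    field_simp
    ring
  · rw [real_inner_comm]
    calc ‖g x‖ ≤ δ * ‖η‖ / (1 - ε) * ‖x‖ := g.le_of_opNorm_le hg x
      _ ≤ (δ + ε) * ‖η‖ / (1 - ε) * ‖x‖ := by
        gcongr
        exact le_add_of_nonneg_right ε.2
      _ = (δ + ε) / (1 - ε) * (‖x‖ * ‖η‖) := by ring

theorem isNearIsometryAt_comp_subtype {E F : Type*} [NormedAddCommGroup E] [NormedSpace ℝ E]
    [NormedAddCommGroup F] [InnerProductSpace ℝ F] {A : E →ₗ[ℝ] F} {η : F} {δ : ℝ}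
    {W : Submodule ℝ E} {x : W} :
    IsNearIsometryAt (A ∘ₗ W.subtype) η δ x ↔ IsNearIsometryAt A η δ (x : E) :=
  ⟨fun h => ⟨h.le_norm, h.norm_le, h.abs_inner_le⟩,
    fun h => ⟨h.le_norm, h.norm_le, h.abs_inner_le⟩⟩

theorem exists_forall_isNearIsometryAt_of_finrank_le {m n : ℕ} {ι : Type*} [Fintype ι]
    (W : ι → Submodule ℝ (EuclideanSpace ℝ (Fin n))) {d : ℕ} (hW : ∀ i, finrank ℝ (W i) ≤ d)
    (η : EuclideanSpace ℝ (Fin m)) :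
    ∃ S : Set (Fin m → Fin n → ℝ), MeasurableSet S ∧
      1 - Fintype.card ι * 25 ^ d * (4 * Real.exp (-(m / 200))) ≤ (gaussianMatrixLaw m n).real S ∧
      ∀ a ∈ S, ∀ i, ∀ x ∈ W i,
        IsNearIsometryAt (Matrix.toEuclideanLin (Matrix.of a)) η (1 / 5) x := by
  classical
  choose s hnorm hcover hcard using fun i =>
    exists_finset_isCover_sphere (E := W i) (ε := 1 / 12) (by norm_num)
  let T : Finset (EuclideanSpace ℝ (Fin n)) :=
    Finset.univ.biUnion fun i => (s i).image Subtype.val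
  have hcard' : ∀ i, ((s i).image Subtype.val).card ≤ 25 ^ d := fun i => by
    have hs : ((s i).card : ℝ) ≤ 25 ^ d := calc
      ((s i).card : ℝ) ≤ (1 + 2 / (1 / 12 : ℝ≥0)) ^ finrank ℝ (W i) := hcard i
      _ = 25 ^ finrank ℝ (W i) := by norm_num
      _ ≤ 25 ^ d := pow_le_pow_right₀ (by norm_num) (hW i)
    exact Finset.card_image_le.trans (by exact_mod_cast hs)
  have hT : (T.card : ℝ) ≤ Fintype.card ι * 25 ^ d := by
    exact_mod_cast Finset.card_biUnion_le_card_mul _ _ _ fun i _ => hcard' i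
  refine ⟨{a | ∀ x ∈ T, IsNearIsometryAt (Matrix.toEuclideanLin (Matrix.of a)) η (1 / 10) x},
    ?_, ?_, fun a ha i x hx => ?_⟩
  · simpa only [Set.ofPred_forall] using
      T.measurableSet_biInter fun x _ => measurableSet_isNearIsometryAt η (1 / 10) x
  · refine le_trans ?_ (le_gaussianMatrixLaw_forall_isNearIsometryAt η (by norm_num)
      (by norm_num) T)
    rw [show (m * (1 / 10) ^ 2 / 2 : ℝ) = m / 200 by ring]
    gcongr
  · have hnet : ∀ c ∈ s i, IsNearIsometryAt
        (Matrix.toEuclideanLin (Matrix.of a) ∘ₗ (W i).subtype) η (1 / 10) c := fun c hc =>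
      isNearIsometryAt_comp_subtype.2 (ha c (Finset.mem_biUnion.2
        ⟨i, Finset.mem_univ i, Finset.mem_image_of_mem _ hc⟩))
    have hδ : (1 / 10 + (1 / 12 : ℝ≥0)) / (1 - (1 / 12 : ℝ≥0)) = (1 / 5 : ℝ) := by norm_num
    exact isNearIsometryAt_comp_subtype.1 (hδ ▸ IsNearIsometryAt.of_isCover_sphere (hcover i)
      (by norm_num [← NNReal.coe_lt_coe]) (by norm_num) (hnorm i) hnet ⟨x, hx⟩)

/-! ### Sign patterns of linear maps -/

section SignPattern

open Finset

variable {E ι : Type*} [AddCommGroup E] [Module ℝ E] [Fintype ι] {v : ι → ℝ}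

/-- The set of coordinates in which `v` is positive, that is, in which the ReLU is active. -/
noncomputable def posSupport (v : ι → ℝ) : Finset ι := {r | 0 < v r}

theorem mem_posSupport {r : ι} : r ∈ posSupport v ↔ 0 < v r := by
  simp [posSupport]

open Classical in
/-- The activation patterns of a ReLU channel: the sets of positive coordinates of the vectors in
the range of `L`. -/
noncomputable def signPatterns (L : E →ₗ[ℝ] ι → ℝ) : Finset (Finset ι) :=
  {S | ∃ w, posSupport (L w) = S}

theorem mem_signPatterns {L : E →ₗ[ℝ] ι → ℝ} {S : Finset ι} :
    S ∈ signPatterns L ↔ ∃ w, posSupport (L w) = S := by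
  simp [signPatterns]

theorem sum_mul_pos_of_pos_iff {g : ι → ℝ} (hgv : ∀ i, 0 < g i ↔ 0 < v i) {i : ι} (hi : 0 < g i) :
    0 < ∑ j, g j * v j := by
  refine sum_pos' (fun j _ => ?_) ⟨i, mem_univ i, mul_pos hi ((hgv i).1 hi)⟩
  rcases lt_or_ge 0 (g j) with hj | hj
  · exact (mul_pos hj ((hgv j).1 hj)).le
  · exact mul_nonneg_of_nonpos_of_nonpos hj (not_lt.1 fun h => hj.not_gt ((hgv j).2 h))

variable {L : E →ₗ[ℝ] ι → ℝ} {s : Finset ι}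

theorem exists_pos_iff_of_shatters [DecidableEq ι] (hs : (signPatterns L).Shatters s)
    (g : s → ℝ) : ∃ w, ∀ r : s, 0 < g r ↔ 0 < L w r := by
  obtain ⟨u, hu, hsu⟩ := hs (t := (posSupport g).map (Function.Embedding.subtype _))
    (map_subtype_subset _)
  obtain ⟨w, rfl⟩ := mem_signPatterns.1 hu
  refine ⟨w, fun r => ?_⟩
  have hr := Finset.ext_iff.1 hsu r
  simpa [mem_posSupport] using hr.symm

-- A linear relation among the rows in `s` is violated by a `w` realizing its sign pattern.
theorem linearIndependent_of_shatters [DecidableEq ι] (hs : (signPatterns L).Shatters s) :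
    LinearIndependent ℝ fun r : s => (LinearMap.proj (r : ι) ∘ₗ L : Dual ℝ E) := by
  have hnonpos : ∀ g : s → ℝ, (∀ w, ∑ r : s, g r * L w r = 0) → ∀ r, g r ≤ 0 := by
    intro g hg r
    by_contra! hr
    obtain ⟨w, hw⟩ := exists_pos_iff_of_shatters hs g
    exact (sum_mul_pos_of_pos_iff hw hr).ne' (hg w)
  refine Fintype.linearIndependent_iff.2 fun g hg r => ?_
  have hg' : ∀ w, ∑ r : s, g r * L w r = 0 := fun w => by simpa using LinearMap.congr_fun hg w
  have hneg := hnonpos (-g) (fun w => by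
    simpa only [Pi.neg_apply, neg_mul, sum_neg_distrib, neg_eq_zero] using hg' w) r
  exact le_antisymm (hnonpos g hg' r) (by simpa using hneg)

variable [FiniteDimensional ℝ E]

theorem card_le_finrank_of_shatters [DecidableEq ι] (hs : (signPatterns L).Shatters s) :
    #s ≤ finrank ℝ E := by
  simpa [Subspace.dual_finrank_eq] using
    (linearIndependent_of_shatters hs).fintype_card_le_finrank

theorem sum_choose_le_succ_pow (n p : ℕ) : ∑ i ∈ Iic p, n.choose i ≤ (n + 1) ^ p := by
  rw [add_pow, Nat.range_succ_eq_Iic]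
  refine sum_le_sum fun i hi => ?_
  rw [one_pow, mul_one]
  exact (n.choose_le_pow i).trans (Nat.le_mul_of_pos_right _ (Nat.choose_pos (mem_Iic.1 hi)))

theorem card_signPatterns_le (L : E →ₗ[ℝ] ι → ℝ) :
    #(signPatterns L) ≤ (Fintype.card ι + 1) ^ finrank ℝ E := by
  classical
  have hvc : (signPatterns L).vcDim ≤ finrank ℝ E :=
    Finset.sup_le fun s hs => card_le_finrank_of_shatters (mem_shatterer.1 hs)
  calc #(signPatterns L) ≤ #(signPatterns L).shatterer := card_le_card_shatterer _
    _ ≤ ∑ i ∈ Iic (signPatterns L).vcDim, (Fintype.card ι).choose i := card_shatterer_le_sum_vcDim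
    _ ≤ (Fintype.card ι + 1) ^ (signPatterns L).vcDim := sum_choose_le_succ_pow _ _
    _ ≤ (Fintype.card ι + 1) ^ finrank ℝ E := Nat.pow_le_pow_right (Nat.succ_pos _) hvc

end SignPattern

/-! ### Recovery -/

section Recovery

variable {m n : ℕ} {Θ : Type} {G : Θ → EuclideanSpace ℝ (Fin n)}

theorem residual_toEuclideanLin_add (A : Matrix (Fin m) (Fin n) ℝ)
    (xstar x : EuclideanSpace ℝ (Fin n)) (η : EuclideanSpace ℝ (Fin m)) :
    residual A (Matrix.toEuclideanLin A xstar + η) x =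
      ‖Matrix.toEuclideanLin A (x - xstar) - η‖ := by
  rw [residual, norm_sub_rev, map_sub, sub_sub]

theorem IsApproxMinimizer.norm_sub_le {A : Matrix (Fin m) (Fin n) ℝ}
    {xstar : EuclideanSpace ℝ (Fin n)} {η : EuclideanSpace ℝ (Fin m)} {ε : ℝ} {Chat : Θ}
    (h : IsApproxMinimizer G A (Matrix.toEuclideanLin A xstar + η) ε Chat) (C : Θ) :
    ‖Matrix.toEuclideanLin A (G Chat - xstar) - η‖ ≤
      ‖Matrix.toEuclideanLin A (G C - xstar) - η‖ + ε := by
  have hbdd : BddBelow (Set.range fun C =>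
      residual A (Matrix.toEuclideanLin A xstar + η) (G C)) :=
    ⟨0, Set.forall_mem_range.2 fun _ => norm_nonneg _⟩
  simpa only [residual_toEuclideanLin_add] using h.trans (add_le_add_left (ciInf_le hbdd C) ε)

theorem IsNearIsometryAt.norm_le_of_norm_sub_le {E F : Type*} [NormedAddCommGroup E]
    [NormedSpace ℝ E] [NormedAddCommGroup F] [InnerProductSpace ℝ F] {A : E →ₗ[ℝ] F} {η : F}
    {x : E} (hx : IsNearIsometryAt A η (1 / 5) x) {R : ℝ} (hR : 0 ≤ R)
    (h : ‖A x - η‖ ≤ ‖η‖ + R) : ‖x‖ ≤ 3 / 2 * ‖η‖ + 2 * R := by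
  have hlow : (4 / 5 * ‖x‖) ^ 2 ≤ ‖A x‖ ^ 2 :=
    pow_le_pow_left₀ (by positivity) (by linarith [hx.le_norm]) 2
  have hsq : ‖A x‖ ^ 2 - 2 * inner ℝ (A x) η + ‖η‖ ^ 2 ≤ (‖η‖ + R) ^ 2 := by
    rw [← norm_sub_sq_real]
    exact pow_le_pow_left₀ (norm_nonneg _) h 2
  have hquad : 16 / 25 * ‖x‖ ^ 2 ≤ 2 / 5 * (‖x‖ * ‖η‖) + 2 * (‖η‖ * R) + R ^ 2 := by
    linarith [(abs_le.1 hx.abs_inner_le).2]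
  by_contra! hlt
  have hη := norm_nonneg η
  have hx0 : 0 < ‖x‖ := lt_of_le_of_lt (by positivity) hlt
  nlinarith [mul_nonneg hη hR, mul_nonneg hη (sub_pos.2 hlt).le, mul_nonneg hR (sub_pos.2 hlt).le,
    mul_pos hx0 (sub_pos.2 hlt)]

theorem mem_recoveryEvent_of_isNearIsometryAt {xstar : EuclideanSpace ℝ (Fin n)}
    {η : EuclideanSpace ℝ (Fin m)} {ε : ℝ} (hε : 0 ≤ ε) {a : Fin m → Fin n → ℝ}
    (ha : ∀ C, IsNearIsometryAt (Matrix.toEuclideanLin (Matrix.of a)) η (1 / 5) (G C - xstar)) :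
    a ∈ recoveryEvent G xstar η ε := by
  intro Chat hmin
  have : Nonempty Θ := ⟨Chat⟩
  have hbound : ∀ C, ‖G Chat - xstar‖ ≤
      3 / 2 * ‖η‖ + 2 * (6 / 5 * ‖G C - xstar‖ + ε) := fun C => by
    refine (ha Chat).norm_le_of_norm_sub_le (by positivity) ((hmin.norm_sub_le C).trans ?_)
    linarith [(ha C).norm_le,
      norm_sub_le (Matrix.toEuclideanLin (Matrix.of a) (G C - xstar)) η]
  have hinf : (‖G Chat - xstar‖ - 3 / 2 * ‖η‖ - 2 * ε) / 6 ≤ ⨅ C, ‖G C - xstar‖ :=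
    le_ciInf fun C => by linarith [hbound C, norm_nonneg (G C - xstar)]
  linarith

theorem recoversWithHighProb_of_forall_eq {c : ℝ} (hG : ∀ C C', G C = G C') :
    RecoversWithHighProb m c G := by
  intro xstar η ε hε
  refine ⟨Set.univ, MeasurableSet.univ, fun a _ Chat _ => ?_, ?_⟩
  · have : Nonempty Θ := ⟨Chat⟩
    have hinf : ⨅ C, ‖G C - xstar‖ = ‖G Chat - xstar‖ := by
      simp only [hG _ Chat, ciInf_const]
    linarith [norm_nonneg (G Chat - xstar), norm_nonneg η]
  · rw [probReal_univ]
    linarith [Real.exp_nonneg (-(c * m))]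

-- The largest value of `p + q` under the Pythagorean constraint `p ^ 2 + q ^ 2 = ‖η‖ ^ 2`, with
-- `p` and `q` the norms of the components of `η` along and orthogonal to `K`.
theorem norm_le_sqrt_two_mul_of_isApproxNearest {F : Type*} [NormedAddCommGroup F]
    [InnerProductSpace ℝ F] (K : Submodule ℝ F) [K.HasOrthogonalProjection] {v η : F} {ε : ℝ}
    (hv : v ∈ K) (hε : 0 ≤ ε) (hmin : ∀ w ∈ K, ‖v - η‖ ≤ ‖w - η‖ + ε) :
    ‖v‖ ≤ √2 * ‖η‖ + ε := by
  set p := K.starProjection η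
  have hpK : p ∈ K := K.starProjection_apply_mem η
  have hpyth : ∀ w ∈ K, ‖w - η‖ ^ 2 = ‖w - p‖ ^ 2 + ‖p - η‖ ^ 2 := fun w hw => by
    have horth : inner ℝ (w - p) (p - η) = 0 := by
      rw [← neg_sub η p, inner_neg_right, real_inner_comm,
        K.starProjection_inner_eq_zero η _ (K.sub_mem hw hpK), neg_zero]
    rw [← sub_add_sub_cancel w p η, norm_add_sq_real, horth, mul_zero, add_zero]
  have hvp : ‖v - p‖ ≤ ‖p - η‖ + ε := by
    have hsq := pow_le_pow_left₀ (norm_nonneg _) (hmin p hpK) 2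
    rw [hpyth v hv] at hsq
    exact le_of_sq_le_sq (by linarith [sq_nonneg ‖p - η‖]) (by positivity)
  have hpη : ‖p‖ + ‖p - η‖ ≤ √2 * ‖η‖ := by
    have hsq := hpyth 0 K.zero_mem
    rw [zero_sub, zero_sub, norm_neg, norm_neg] at hsq
    refine le_of_sq_le_sq ?_ (by positivity)
    rw [mul_pow, Real.sq_sqrt zero_le_two, hsq]
    exact add_sq_le
  linarith [norm_le_norm_add_norm_sub' v p]

theorem mem_recoveryEvent_of_surjective (hG : Function.Surjective G)
    {xstar : EuclideanSpace ℝ (Fin n)} {η : EuclideanSpace ℝ (Fin m)} {ε : ℝ} (hε : 0 ≤ ε)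
    {a : Fin m → Fin n → ℝ}
    (ha : ∀ x, (1 - 1 / 20) * ‖x‖ ≤ ‖Matrix.toEuclideanLin (Matrix.of a) x‖) :
    a ∈ recoveryEvent G xstar η ε := by
  intro Chat hmin
  have himage := norm_le_sqrt_two_mul_of_isApproxNearest
    (LinearMap.range (Matrix.toEuclideanLin (Matrix.of a))) ⟨G Chat - xstar, rfl⟩ hε <| by
      rintro _ ⟨x, rfl⟩
      obtain ⟨C, hC⟩ := hG (xstar + x)
      simpa only [hC, add_sub_cancel_left] using hmin.norm_sub_le C
  have hsqrt : √2 ≤ 1.42 := Real.sqrt_le_iff.2 (by norm_num)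
  have hinf : 0 ≤ ⨅ C, ‖G C - xstar‖ := Real.iInf_nonneg fun _ => norm_nonneg _
  linarith [ha (G Chat - xstar), mul_le_mul_of_nonneg_right hsqrt (norm_nonneg η), norm_nonneg η]

theorem recoversWithHighProb_of_surjective (hn : n ≤ 1) (hG : Function.Surjective G) :
    RecoversWithHighProb m (1 / 800) G := by
  obtain ⟨e, he⟩ := (finrank_le_one_iff (K := ℝ) (V := EuclideanSpace ℝ (Fin n))).1
    (by simpa using hn)
  intro xstar η ε hε
  let S : Set (Fin m → Fin n → ℝ) :=
    {a | ‖Matrix.toEuclideanLin (Matrix.of a) e‖ < (1 - 1 / 20) * ‖e‖}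
  have hS : MeasurableSet S :=
    measurableSet_lt (measurable_toEuclideanLin_of e).norm measurable_const
  refine ⟨Sᶜ, hS.compl, fun a ha => mem_recoveryEvent_of_surjective hG hε fun x => ?_, ?_⟩
  · obtain ⟨t, rfl⟩ := he x
    rw [map_smul, norm_smul, norm_smul, mul_left_comm]
    exact mul_le_mul_of_nonneg_left (not_lt.1 ha) (norm_nonneg t)
  · rw [probReal_compl_eq_one_sub hS, show (1 / 800 * m : ℝ) = m * (1 / 20) ^ 2 / 2 by ring]
    exact sub_le_sub_left (gaussianMatrixLaw_norm_lt_le e (by norm_num) (by norm_num)) 1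

theorem recoversWithHighProb_of_smul_mem_range (hn : n ≤ 1)
    (hG : ∀ C (t : ℝ), ∃ C', G C' = t • G C) : RecoversWithHighProb m (1 / 800) G := by
  by_cases hzero : ∀ C, G C = 0
  · exact recoversWithHighProb_of_forall_eq fun C C' => (hzero C).trans (hzero C').symm
  · obtain ⟨C, hC⟩ := not_forall.1 hzero
    have : Nontrivial (EuclideanSpace ℝ (Fin n)) := nontrivial_of_ne _ _ hC
    have hdim : finrank ℝ (EuclideanSpace ℝ (Fin n)) = 1 :=
      le_antisymm (by simpa using hn) finrank_pos
    refine recoversWithHighProb_of_surjective hn fun x => ?_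
    obtain ⟨t, rfl⟩ := exists_smul_eq_of_finrank_eq_one hdim hC x
    exact hG C t

theorem union_bound_le_exp {m n d N : ℕ} (hn : 2 ≤ n) (hd : 0 < d) (hN : N ≤ (n + 1) ^ d)
    (hm : 4000 * (d * Real.log n) ≤ m) :
    N * 25 ^ (d + 1) * (4 * Real.exp (-(m / 200))) ≤ Real.exp (-(1 / 800 * m)) := by
  have hn' : (0 : ℝ) < n := by positivity
  have hcount : (N * 25 ^ (d + 1) * 4 : ℝ) ≤ Real.exp (14 * (d * Real.log n)) := by
    have hnat : N * 25 ^ (d + 1) * 4 ≤ n ^ (14 * d) := calc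
      N * 25 ^ (d + 1) * 4 ≤ (n ^ 2) ^ d * (n ^ 5) ^ (2 * d) * (n ^ 2) ^ d := by
        gcongr ?_ * ?_ * ?_
        · exact hN.trans (Nat.pow_le_pow_left (by nlinarith) d)
        · exact (Nat.pow_le_pow_right (by norm_num) (by lia)).trans
            (Nat.pow_le_pow_left ((by norm_num : 25 ≤ 2 ^ 5).trans (Nat.pow_le_pow_left hn 5)) _)
        · exact (Nat.pow_le_pow_left hn 2).trans (Nat.le_self_pow hd.ne' _)
      _ = n ^ (14 * d) := by ring
    calc (N * 25 ^ (d + 1) * 4 : ℝ) ≤ (n : ℝ) ^ (14 * d) := by exact_mod_cast hnat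
      _ = Real.exp (14 * (d * Real.log n)) := by
        rw [← Real.exp_log hn', ← Real.exp_nat_mul, Real.log_exp]
        push_cast
        ring_nf
  calc N * 25 ^ (d + 1) * (4 * Real.exp (-(m / 200)))
      = N * 25 ^ (d + 1) * 4 * Real.exp (-(m / 200)) := by ring
    _ ≤ Real.exp (14 * (d * Real.log n)) * Real.exp (-(m / 200)) := by gcongr
    _ ≤ Real.exp (-(1 / 800 * m)) := by
      rw [← Real.exp_add]
      gcongr
      linarith

theorem recoversWithHighProb_of_forall_exists_mem {ι : Type*} [Fintype ι]
    (V : ι → Submodule ℝ (EuclideanSpace ℝ (Fin n))) {d : ℕ} (hG : ∀ C, ∃ i, G C ∈ V i)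
    (hV : ∀ i, finrank ℝ (V i) ≤ d) (hι : Fintype.card ι ≤ (n + 1) ^ d) (hn : 2 ≤ n) (hd : 0 < d)
    (hm : 4000 * (d * Real.log n) ≤ m) : RecoversWithHighProb m (1 / 800) G := by
  intro xstar η ε hε
  have hW : ∀ i, finrank ℝ ↥(V i ⊔ Submodule.span ℝ {xstar}) ≤ d + 1 := fun i =>
    (Submodule.finrank_add_le_finrank_add_finrank _ _).trans
      (add_le_add (hV i) (by simpa using finrank_span_le_card (R := ℝ) {xstar}))
  obtain ⟨S, hS, hprob, hiso⟩ := exists_forall_isNearIsometryAt_of_finrank_le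
    (fun i => V i ⊔ Submodule.span ℝ {xstar}) hW η
  refine ⟨S, hS, fun a ha => mem_recoveryEvent_of_isNearIsometryAt hε fun C => ?_, ?_⟩
  · obtain ⟨i, hi⟩ := hG C
    exact hiso a ha i _ (Submodule.sub_mem_sup hi (Submodule.mem_span_singleton_self xstar))
  · exact (sub_le_sub_left (union_bound_le_exp hn hd hι hm) 1).trans hprob

end Recovery

/-! ### ReLU layers -/

section Layer

variable {ι κ E : Type*} [Fintype κ] [AddCommGroup E] [Module ℝ E]

/-- A ReLU layer with linear channels: channel `i` is the ReLU of `L i (C.1 i)`, and the output is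
the combination of the channels with weights `C.2`. It covers both kinds of deep decoder, `E` being
the space of parameters of one channel. -/
def layer (L : κ → E →ₗ[ℝ] ι → ℝ) (C : (κ → E) × (κ → ℝ)) : EuclideanSpace ℝ ι :=
  WithLp.toLp 2 ((Matrix.of fun r i => max 0 (L i (C.1 i) r)) *ᵥ C.2)

theorem layer_apply (L : κ → E →ₗ[ℝ] ι → ℝ) (C : (κ → E) × (κ → ℝ)) (r : ι) :
    layer L C r = ∑ i, max 0 (L i (C.1 i) r) * C.2 i :=
  rfl

theorem layer_smul (L : κ → E →ₗ[ℝ] ι → ℝ) (C : (κ → E) × (κ → ℝ)) (t : ℝ) :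
    layer L (C.1, t • C.2) = t • layer L C := by
  rw [layer, Matrix.mulVec_smul, WithLp.toLp_smul, layer]

/-- The linear map computed by a ReLU layer whose channel `i` is active exactly on `S i`; its
argument is the family of the channel parameters multiplied by their output weights. -/
noncomputable def frozenLayer (L : κ → E →ₗ[ℝ] ι → ℝ) (S : κ → Finset ι) :
    (κ → E) →ₗ[ℝ] EuclideanSpace ℝ ι :=
  open Classical in
  (WithLp.linearEquiv 2 ℝ (ι → ℝ)).symm ∘ₗ LinearMap.pi fun r =>
    ∑ i with r ∈ S i, LinearMap.proj r ∘ₗ L i ∘ₗ LinearMap.proj i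

theorem layer_eq_frozenLayer [Fintype ι] (L : κ → E →ₗ[ℝ] ι → ℝ) (C : (κ → E) × (κ → ℝ)) :
    layer L C = frozenLayer L (fun i => posSupport (L i (C.1 i))) (fun i => C.2 i • C.1 i) := by
  classical
  ext r
  have happly : frozenLayer L (fun i => posSupport (L i (C.1 i))) (fun i => C.2 i • C.1 i) r =
      ∑ i with r ∈ posSupport (L i (C.1 i)), L i (C.2 i • C.1 i) r := by
    simp [frozenLayer]
  rw [layer_apply, happly, Finset.sum_filter]
  refine Finset.sum_congr rfl fun i _ => ?_
  rw [map_smul, Pi.smul_apply, smul_eq_mul]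
  split_ifs with h
  · rw [max_eq_right (mem_posSupport.1 h).le, mul_comm]
  · rw [max_eq_left (not_lt.1 (mt mem_posSupport.2 h)), zero_mul]

end Layer

/-! ### The convolutional layer as a linear map -/

section Convolution

variable {n n₁ k l : ℕ}

theorem convMatrix_add (c d : Fin l → ℝ) :
    convMatrix n (c + d) = convMatrix n c + convMatrix n d := by
  ext r s
  simp only [convMatrix, Matrix.of_apply, Matrix.add_apply, Pi.add_apply,
    ← Finset.sum_add_distrib, ite_add_ite, add_zero]

theorem convMatrix_smul (t : ℝ) (c : Fin l → ℝ) : convMatrix n (t • c) = t • convMatrix n c := by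
  ext r s
  simp only [convMatrix, Matrix.of_apply, Matrix.smul_apply, Pi.smul_apply, smul_eq_mul,
    Finset.mul_sum, mul_ite, mul_zero]

/-- The preactivation `∑ j, T(c j) U b_j` of a channel of the deep decoder, as a linear map in the
filters `c j` of that channel. -/
def preactivation (l : ℕ) (U : Matrix (Fin n) (Fin n₁) ℝ) (B : Matrix (Fin n₁) (Fin k) ℝ) :
    (Fin k → Fin l → ℝ) →ₗ[ℝ] Fin n → ℝ where
  toFun c := ∑ j, convMatrix n (c j) *ᵥ (U *ᵥ fun p => B p j)
  map_add' c d := by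
    simp only [Pi.add_apply, convMatrix_add, Matrix.add_mulVec, Finset.sum_add_distrib]
  map_smul' t c := by
    simp only [Pi.smul_apply, convMatrix_smul, Matrix.smul_mulVec, Finset.smul_sum,
      RingHom.id_apply]

/-- The filters `γ j • g j` of a channel of the deep decoder with fixed filters, as a linear map in
the scalars `γ j`. -/
def scaleFilters (g : Fin k → Fin l → ℝ) : (Fin k → ℝ) →ₗ[ℝ] Fin k → Fin l → ℝ :=
  LinearMap.pi fun j => (LinearMap.proj j).smulRight (g j)

theorem decoder_eq_layer (U : Matrix (Fin n) (Fin n₁) ℝ) (B : Matrix (Fin n₁) (Fin k) ℝ) :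
    decoder l U B = layer fun _ => preactivation l U B :=
  rfl

theorem fixedDecoder_eq_layer (U : Matrix (Fin n) (Fin n₁) ℝ) (B : Matrix (Fin n₁) (Fin k) ℝ)
    (g : Fin k → Fin k → Fin l → ℝ) :
    fixedDecoder U B g = layer fun i => preactivation l U B ∘ₗ scaleFilters (g i) :=
  rfl

end Convolution

end DeepDecoder

theorem theorem2_general {m n : ℕ} {κ E : Type} [Fintype κ] [AddCommGroup E] [Module ℝ E]
    [FiniteDimensional ℝ E] (L : κ → E →ₗ[ℝ] Fin n → ℝ)
    (hm : 4000 * (Fintype.card κ * Module.finrank ℝ E * Real.log n) ≤ m) :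
    DeepDecoder.RecoversWithHighProb m (1 / 800) (DeepDecoder.layer L) := by
  classical
  have hdim : Module.finrank ℝ (κ → E) = Fintype.card κ * Module.finrank ℝ E := by
    simp [Module.finrank_pi_fintype]
  rcases le_or_gt n 1 with hn | hn
  · exact DeepDecoder.recoversWithHighProb_of_smul_mem_range hn fun C t =>
      ⟨_, DeepDecoder.layer_smul L C t⟩
  rcases Nat.eq_zero_or_pos (Fintype.card κ * Module.finrank ℝ E) with hd | hd
  · have : Subsingleton (κ → E) := Module.finrank_zero_iff.1 (hdim.trans hd)
    exact DeepDecoder.recoversWithHighProb_of_forall_eq fun C C' => by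
      simp only [DeepDecoder.layer_eq_frozenLayer, Subsingleton.elim _ (0 : κ → E), map_zero]
  refine DeepDecoder.recoversWithHighProb_of_forall_exists_mem
    (ι := (i : κ) → DeepDecoder.signPatterns (L i))
    (fun S => LinearMap.range (DeepDecoder.frozenLayer L fun i => (S i).1)) (fun C => ?_)
    (fun S => ?_) ?_ hn hd (by exact_mod_cast hm)
  · exact ⟨fun i => ⟨_, DeepDecoder.mem_signPatterns.2 ⟨C.1 i, rfl⟩⟩, _,
      (DeepDecoder.layer_eq_frozenLayer L C).symm⟩
  · exact (LinearMap.finrank_range_le _).trans hdim.le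
  · rw [Fintype.card_pi]
    simp only [Fintype.card_coe]
    refine (Finset.prod_le_prod' fun i _ => DeepDecoder.card_signPatterns_le (L i)).trans ?_
    simp [← pow_mul, mul_comm]

theorem theorem2 :
    ∃ K c : ℝ, 0 < K ∧ 0 < c ∧
      ∀ (m n n₁ k l : ℕ) (U : Matrix (Fin n) (Fin n₁) ℝ) (B : Matrix (Fin n₁) (Fin k) ℝ),
        (K * (l * (k : ℝ) ^ 2 * Real.log n) ≤ m →
          DeepDecoder.RecoversWithHighProb m c (DeepDecoder.decoder l U B)) ∧
        (∀ g : Fin k → Fin k → Fin l → ℝ, K * ((k : ℝ) ^ 2 * Real.log n) ≤ m →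
          DeepDecoder.RecoversWithHighProb m c (DeepDecoder.fixedDecoder U B g)) := by
  refine ⟨4000, 1 / 800, by norm_num, by norm_num, fun m n n₁ k l U B =>
    ⟨fun hm => ?_, fun g hm => ?_⟩⟩
  · rw [DeepDecoder.decoder_eq_layer]
    refine theorem2_general _ (le_of_eq_of_le ?_ hm)
    simp only [Module.finrank_pi_fintype, Module.finrank_self, Finset.sum_const, Finset.card_univ,
      Fintype.card_fin, smul_eq_mul, mul_one, Nat.cast_mul]
    ring
  · rw [DeepDecoder.fixedDecoder_eq_layer]
    refine theorem2_general _ (le_of_eq_of_le ?_ hm)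
    simp only [Module.finrank_pi_fintype, Module.finrank_self, Finset.sum_const, Finset.card_univ,
      Fintype.card_fin, smul_eq_mul, mul_one]
    ring
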